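/- For positive integers $m,n,p$, let $\mathbb{R}^{m\times n\times p}$ be the space of real $m\times n\times p$ tensors $T=(t_{ijk})$. The rank of $T$ is the least $r\ge 0$ such that $T$ is a sum of $r$ tensors of the form $\mathbf a\otimes\mathbf b\otimes\mathbf c=(a_ib_jc_k)_{ijk}$ with $\mathbf a\in\mathbb{R}^m$, $\mathbf b\in\mathbb{R}^n$, $\mathbf c\in\mathbb{R}^p$. An integer $r$ is a typical rank of $m\times n\times p$ tensors over $\mathbb{R}$ if there is a (measurable) set $S\subset\mathbb{R}^{m\times n\times p}$ of positive Lebesgue measure such that every $T\in S$ has rank $r$. **Theorem.** Let $m\le n$ be positive integers and set $p=(m-1)(n-1)+1$. Then there are at least two typical ranks of $m\times n\times p$ tensors over $\mathbb{R}$ in each of the following cases: 1. $m=3$ and $n\equiv 3\pmod 4$; 2. $m=4$ and $n\equiv 2\pmod 4$; 3. $m=6$ and $n\equiv 4\pmod 8$; 4. $m=10$ and $n\equiv 24\pmod{32}$. -/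

import Mathlib

/-- Real `m × n × p` tensors, as three-dimensional arrays; this space is `ℝ ^ (m n p)` and its
`volume` is the Lebesgue measure. -/
abbrev Tensor3 (m n p : ℕ) : Type := Fin m → Fin n → Fin p → ℝ

/-- The rank-one tensor `a ⊗ b ⊗ c`, with entries `a i * b j * c k`. -/
def outerProduct {m n p : ℕ} (a : Fin m → ℝ) (b : Fin n → ℝ) (c : Fin p → ℝ) : Tensor3 m n p :=
  fun i j k => a i * b j * c k

/-- `T` is a sum of `r` tensors of the form `a ⊗ b ⊗ c`. -/
def IsSumOfOuterProducts {m n p : ℕ} (T : Tensor3 m n p) (r : ℕ) : Prop :=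
  ∃ (a : Fin r → Fin m → ℝ) (b : Fin r → Fin n → ℝ) (c : Fin r → Fin p → ℝ),
    T = ∑ u, outerProduct (a u) (b u) (c u)

/-- Every tensor is a finite sum of outer products, so the infimum in `tensorRank` is a minimum. -/
theorem exists_isSumOfOuterProducts {m n p : ℕ} (T : Tensor3 m n p) :
    ∃ r, IsSumOfOuterProducts T r := by
  let e := Fintype.equivFin (Fin m × Fin n × Fin p)
  refine ⟨_, fun u => Pi.single (e.symm u).1 (T (e.symm u).1 (e.symm u).2.1 (e.symm u).2.2),
    fun u => Pi.single (e.symm u).2.1 1, fun u => Pi.single (e.symm u).2.2 1, ?_⟩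
  funext i j k
  simp only [Finset.sum_apply, outerProduct]
  rw [Equiv.sum_comp e.symm (fun x : Fin m × Fin n × Fin p =>
    (Pi.single x.1 (T x.1 x.2.1 x.2.2) : Fin m → ℝ) i * (Pi.single x.2.1 1 : Fin n → ℝ) j *
      (Pi.single x.2.2 1 : Fin p → ℝ) k)]
  simp [Fintype.sum_prod_type, Pi.single_apply]

/-- The rank of a tensor over `ℝ`: the least number of tensors `a ⊗ b ⊗ c` that sum to it. -/
noncomputable def tensorRank {m n p : ℕ} (T : Tensor3 m n p) : ℕ :=
  sInf {r | IsSumOfOuterProducts T r}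

/-- The typical ranks of `m × n × p` tensors over `ℝ`: those `r` for which some set of positive
Lebesgue measure consists of tensors of rank `r`. -/
def typicalRanks (m n p : ℕ) : Set ℕ :=
  {r | ∃ S : Set (Tensor3 m n p), MeasurableSet S ∧ 0 < MeasureTheory.volume S ∧
    ∀ T ∈ S, tensorRank T = r}

open MeasureTheory Topology Filter
open scoped Quaternion

/-! If the `p` slices of `T` are independent, `T` has rank at least `p`, with equality only if the
slices' span is itself spanned by rank-one matrices. Two nonempty open sets of tensors then give two
typical ranks.

The value `p` is always typical. Near a configuration of `p` independent rank-one matrices whose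
span is transversal to the rank-one locus, the map from factors to sums of `p` terms is a
submersion, so all nearby tensors have rank exactly `p` (`mem_typicalRanks_of_transversal`,
`section_transversal`).

A value above `p` comes from a nonsingular bilinear map `ℝ^m × ℝ^n → ℝ^(m+n-2)`. The induced linear
map on matrices kills no rank-one matrix, and its kernel has dimension at least `mn - (m+n-2) = p`.
Slices chosen independent in the kernel force rank above `p`, and compactness makes this an open
condition (`isOpen_forall_rankOne_notMem_span`). In the four cases quaternions, octonions or a
ten-dimensional space acting on `ℝ^32` supply the map. -/

instance isOpenPosMeasure_volume_matrix (m n : ℕ) :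
    (volume : Measure (Fin m → Fin n → ℝ)).IsOpenPosMeasure :=
  Measure.pi.isOpenPosMeasure _

instance isOpenPosMeasure_volume_tensor (m n p : ℕ) :
    (volume : Measure (Tensor3 m n p)).IsOpenPosMeasure :=
  Measure.pi.isOpenPosMeasure _

/-! ### Slices, rank and measurability -/

/-- The slices `(t_{ijk})_{ij}` of a tensor. -/
def slices {m n p : ℕ} (T : Tensor3 m n p) : Fin p → Fin m → Fin n → ℝ :=
  fun k i j => T i j k

/-- The rank-one matrix `a bᵀ`. -/
def rankOne {m n : ℕ} (a : Fin m → ℝ) (b : Fin n → ℝ) : Fin m → Fin n → ℝ :=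
  fun i j => a i * b j

theorem continuous_slices {m n p : ℕ} : Continuous (slices : Tensor3 m n p → _) := by
  unfold slices; fun_prop

theorem isOpen_linearIndependent_slices (m n p : ℕ) :
    IsOpen {T : Tensor3 m n p | LinearIndependent ℝ (slices T)} :=
  isOpen_setOfPred_linearIndependent.preimage continuous_slices

theorem slices_mem_span {m n p r : ℕ} {T : Tensor3 m n p} {a : Fin r → Fin m → ℝ}
    {b : Fin r → Fin n → ℝ} {c : Fin r → Fin p → ℝ} (hT : T = ∑ u, outerProduct (a u) (b u) (c u))
    (k : Fin p) : slices T k ∈ Submodule.span ℝ (Set.range fun u => rankOne (a u) (b u)) := by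
  have : slices T k = ∑ u, c u k • rankOne (a u) (b u) := by
    subst hT
    funext i j
    simp [slices, rankOne, outerProduct, Finset.sum_apply, mul_comm]
  rw [this]
  exact Submodule.sum_mem _ fun u _ => Submodule.smul_mem _ _ (Submodule.subset_span ⟨u, rfl⟩)

theorem le_of_isSumOfOuterProducts {m n p r : ℕ} {T : Tensor3 m n p}
    (hT : LinearIndependent ℝ (slices T)) (h : IsSumOfOuterProducts T r) : p ≤ r := by
  obtain ⟨a, b, c, h⟩ := h
  have hle : Submodule.span ℝ (Set.range (slices T)) ≤
      Submodule.span ℝ (Set.range fun u => rankOne (a u) (b u)) :=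
    Submodule.span_le.2 (by rintro _ ⟨k, rfl⟩; exact slices_mem_span h k)
  have h1 := finrank_span_eq_card hT
  have h2 := finrank_range_le_card (R := ℝ) (fun u => rankOne (a u) (b u))
  have h3 := Submodule.finrank_mono hle
  simp only [Fintype.card_fin, Set.finrank] at *
  omega

theorem isSumOfOuterProducts_tensorRank {m n p : ℕ} (T : Tensor3 m n p) :
    IsSumOfOuterProducts T (tensorRank T) :=
  Nat.sInf_mem (exists_isSumOfOuterProducts T)

theorem continuous_sum_outerProduct (m n p r : ℕ) :
    Continuous fun x : (Fin r → Fin m → ℝ) × (Fin r → Fin n → ℝ) × (Fin r → Fin p → ℝ) =>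
      ∑ u, outerProduct (x.1 u) (x.2.1 u) (x.2.2 u) := by
  unfold outerProduct
  fun_prop

/-- The set need not be closed, but as a continuous image of a σ-compact space it is a countable
union of compact sets. -/
theorem measurableSet_isSumOfOuterProducts (m n p r : ℕ) :
    MeasurableSet {T : Tensor3 m n p | IsSumOfOuterProducts T r} := by
  have h := isSigmaCompact_range (continuous_sum_outerProduct m n p r)
  obtain ⟨K, hK, hKu⟩ := h
  have : {T : Tensor3 m n p | IsSumOfOuterProducts T r} = ⋃ i, K i := by
    rw [hKu]
    ext T
    constructor
    · rintro ⟨a, b, c, rfl⟩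
      exact ⟨(a, b, c), rfl⟩
    · rintro ⟨⟨a, b, c⟩, rfl⟩
      exact ⟨a, b, c, rfl⟩
  rw [this]
  exact MeasurableSet.iUnion fun i => (hK i).measurableSet

theorem measurableSet_tensorRank_eq (m n p r : ℕ) :
    MeasurableSet {T : Tensor3 m n p | tensorRank T = r} := by
  have : {T : Tensor3 m n p | tensorRank T = r} =
      {T | IsSumOfOuterProducts T r} ∩ ⋂ s : Fin r, {T | IsSumOfOuterProducts T s}ᶜ := by
    ext T
    simp only [Set.mem_inter_iff, Set.mem_iInter]
    constructor
    · rintro rfl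
      exact ⟨isSumOfOuterProducts_tensorRank T, fun s => Nat.notMem_of_lt_sInf s.2⟩
    · rintro ⟨h1, h2⟩
      refine le_antisymm (Nat.sInf_le h1) (not_lt.1 fun hlt => ?_)
      exact h2 ⟨_, hlt⟩ (isSumOfOuterProducts_tensorRank T)
  rw [this]
  exact (measurableSet_isSumOfOuterProducts m n p r).inter
    (MeasurableSet.iInter fun s => (measurableSet_isSumOfOuterProducts m n p s).compl)

/-- A nonempty open set of tensors contains a typical rank. -/
theorem exists_mem_typicalRanks_of_isOpen {m n p : ℕ} {U : Set (Tensor3 m n p)} (hU : IsOpen U)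
    (hne : U.Nonempty) : ∃ r ∈ typicalRanks m n p, ∃ T ∈ U, tensorRank T = r := by
  have hpos : 0 < volume U := hU.measure_pos volume hne
  have hcover : U = ⋃ r, U ∩ {T | tensorRank T = r} := by
    ext T
    simp
  -- Otherwise countably many null sets would cover `U`.
  have : ∃ r, volume (U ∩ {T | tensorRank T = r}) ≠ 0 := by
    by_contra! h
    rw [hcover, measure_iUnion_null h] at hpos
    exact lt_irrefl _ hpos
  obtain ⟨r, hr⟩ := this
  refine ⟨r, ⟨_, hU.measurableSet.inter (measurableSet_tensorRank_eq m n p r),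
    pos_iff_ne_zero.2 hr, fun T hT => hT.2⟩, ?_⟩
  obtain ⟨T, hT⟩ := nonempty_of_measure_ne_zero hr
  exact ⟨T, hT.1, hT.2⟩

/-! ### The submersion criterion for `p` to be typical -/

theorem exists_hasStrictFDerivAt_sum_outerProduct {m n p r : ℕ}
    (x : (Fin r → Fin m → ℝ) × (Fin r → Fin n → ℝ) × (Fin r → Fin p → ℝ)) :
    ∃ F' : ((Fin r → Fin m → ℝ) × (Fin r → Fin n → ℝ) × (Fin r → Fin p → ℝ)) →L[ℝ] Tensor3 m n p,
      HasStrictFDerivAt (fun x : (Fin r → Fin m → ℝ) × (Fin r → Fin n → ℝ) × (Fin r → Fin p → ℝ) =>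
        ∑ u, outerProduct (x.1 u) (x.2.1 u) (x.2.2 u)) F' x ∧
      ∀ v, F' v = ∑ u, (outerProduct (v.1 u) (x.2.1 u) (x.2.2 u) +
        outerProduct (x.1 u) (v.2.1 u) (x.2.2 u) + outerProduct (x.1 u) (x.2.1 u) (v.2.2 u)) := by
  let E := (Fin r → Fin m → ℝ) × (Fin r → Fin n → ℝ) × (Fin r → Fin p → ℝ)
  let A (u : Fin r) (i : Fin m) : E →L[ℝ] ℝ :=
    (ContinuousLinearMap.proj (R := ℝ) (φ := fun _ : Fin m => ℝ) i).comp
      ((ContinuousLinearMap.proj (R := ℝ) (φ := fun _ : Fin r => Fin m → ℝ) u).comp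
        (ContinuousLinearMap.fst ℝ _ _))
  let B (u : Fin r) (j : Fin n) : E →L[ℝ] ℝ :=
    (ContinuousLinearMap.proj (R := ℝ) (φ := fun _ : Fin n => ℝ) j).comp
      ((ContinuousLinearMap.proj (R := ℝ) (φ := fun _ : Fin r => Fin n → ℝ) u).comp
      ((ContinuousLinearMap.fst ℝ _ _).comp (ContinuousLinearMap.snd ℝ _ _)))
  let C (u : Fin r) (k : Fin p) : E →L[ℝ] ℝ :=
    (ContinuousLinearMap.proj (R := ℝ) (φ := fun _ : Fin p => ℝ) k).comp
      ((ContinuousLinearMap.proj (R := ℝ) (φ := fun _ : Fin r => Fin p → ℝ) u).comp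
      ((ContinuousLinearMap.snd ℝ _ _).comp (ContinuousLinearMap.snd ℝ _ _)))
  refine ⟨ContinuousLinearMap.pi fun i => ContinuousLinearMap.pi fun j =>
    ContinuousLinearMap.pi fun k => ∑ u, ((x.1 u i * x.2.1 u j) • C u k +
      x.2.2 u k • (x.1 u i • B u j + x.2.1 u j • A u i)), ?_, ?_⟩
  · refine hasStrictFDerivAt_pi.2 fun i => hasStrictFDerivAt_pi.2 fun j =>
      hasStrictFDerivAt_pi.2 fun k => ?_
    simp only [Finset.sum_apply, outerProduct]
    exact HasStrictFDerivAt.fun_sum fun u _ =>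
      (((A u i).hasStrictFDerivAt.mul (B u j).hasStrictFDerivAt).mul (C u k).hasStrictFDerivAt)
  · intro v
    funext i j k
    simp only [ContinuousLinearMap.coe_pi', _root_.sum_apply, Finset.sum_apply,
      Pi.add_apply, outerProduct, A, B, C, _root_.add_apply,
      _root_.smul_apply, ContinuousLinearMap.comp_apply, smul_eq_mul,
      ContinuousLinearMap.proj_apply, 
      ContinuousLinearMap.coe_fst', ContinuousLinearMap.coe_snd']
    exact Finset.sum_congr rfl fun u _ => by ring

theorem exists_linearMap_tensor_apply {m n p : ℕ} (f : Tensor3 m n p →ₗ[ℝ] ℝ) :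
    ∃ Z : Tensor3 m n p, ∀ T, f T = ∑ k, ∑ i, ∑ j, T i j k * Z i j k := by
  refine ⟨fun i j k => f (Pi.single i (Pi.single j (Pi.single k 1))), fun T => ?_⟩
  have h : T = ∑ k, ∑ i, ∑ j, T i j k • (Pi.single i (Pi.single j (Pi.single k 1)) :
      Tensor3 m n p) := by
    funext i j k
    simp only [Finset.sum_apply, Pi.smul_apply, smul_eq_mul]
    rw [Finset.sum_eq_single k, Finset.sum_eq_single i, Finset.sum_eq_single j]
    · simp
    · intro b _ hb; simp [hb.symm]
    · simp
    · intro b _ hb; simp [hb.symm]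
    · simp
    · intro b _ hb
      refine Finset.sum_eq_zero fun i' _ => Finset.sum_eq_zero fun j' _ => ?_
      by_cases hi : i = i' <;> by_cases hj : j = j' <;> simp [hb.symm, hi, hj]
    · simp
  conv_lhs => rw [h]
  simp only [map_sum, map_smul, smul_eq_mul]

/-- A configuration of `p` independent rank-one matrices at each of which their span meets the
tangent space of the rank-one matrices transversally makes `p` a typical rank. -/
theorem mem_typicalRanks_of_transversal {m n p : ℕ} (a : Fin p → Fin m → ℝ) (b : Fin p → Fin n → ℝ)
    (hind : LinearIndependent ℝ fun u => rankOne (a u) (b u))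
    (htrans : ∀ u, ∀ Z : Fin m → Fin n → ℝ, (∀ i, ∑ j, b u j * Z i j = 0) →
      (∀ j, ∑ i, a u i * Z i j = 0) → (∀ v, ∑ i, ∑ j, a v i * b v j * Z i j = 0) → Z = 0) :
    p ∈ typicalRanks m n p := by
  -- With this choice the slices of the base tensor are the given rank-one matrices.
  let c : Fin p → Fin p → ℝ := fun u => Pi.single u 1
  obtain ⟨F', hF, hF'⟩ := exists_hasStrictFDerivAt_sum_outerProduct (a, b, c)
  set F := fun x : (Fin p → Fin m → ℝ) × (Fin p → Fin n → ℝ) × (Fin p → Fin p → ℝ) =>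
        ∑ u, outerProduct (x.1 u) (x.2.1 u) (x.2.2 u) with hFdef
  have hsurj : F'.range = ⊤ := by
    -- A functional `Z` vanishing on the range is tested slice by slice. Varying `a u` or `b u`
    -- moves only slice `u`, along the tangent space at the `u`-th matrix; varying `c v` in
    -- coordinate `u` adds the `v`-th matrix to that slice. These are the three hypotheses of
    -- `htrans`.
    by_contra hne
    obtain ⟨f, hf0, hf⟩ := Submodule.exists_le_ker_of_lt_top _ (lt_top_iff_ne_top.2 hne)
    have hf (v) : f (F' v) = 0 := hf ⟨v, rfl⟩
    obtain ⟨Z, hZ⟩ := exists_linearMap_tensor_apply f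
    have hZ0 : ∀ u, (fun i j => Z i j u) = 0 := by
      intro u
      refine htrans u _ (fun i => ?_) (fun j => ?_) (fun v => ?_)
      · have := hf (Pi.single u (Pi.single i 1), 0, 0)
        rw [hF', hZ, Finset.sum_eq_single u, Finset.sum_eq_single i] at this
        · rw [← this]
          refine Finset.sum_congr rfl fun j _ => ?_
          rw [Finset.sum_apply, Finset.sum_apply, Finset.sum_apply, Finset.sum_eq_single u]
          · simp [outerProduct, c]
          · intro v _ hv; simp [outerProduct, hv]
          · simp
        · intro i' _ hi
          refine Finset.sum_eq_zero fun j _ => ?_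
          rw [Finset.sum_apply, Finset.sum_apply, Finset.sum_apply, Finset.sum_eq_zero]
          · simp
          intro v _
          by_cases hv : v = u
          · subst hv; simp [outerProduct, hi]
          · simp [outerProduct, hv]
        · simp
        · intro k _ hk
          refine Finset.sum_eq_zero fun i' _ => Finset.sum_eq_zero fun j _ => ?_
          rw [Finset.sum_apply, Finset.sum_apply, Finset.sum_apply, Finset.sum_eq_zero]
          · simp
          intro v _
          by_cases hv : v = u
          · subst hv; simp [outerProduct, c, hk]
          · simp [outerProduct, hv]
        · simp
      · have := hf (0, Pi.single u (Pi.single j 1), 0)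
        rw [hF', hZ, Finset.sum_eq_single u, Finset.sum_comm, Finset.sum_eq_single j] at this
        · rw [← this]
          refine Finset.sum_congr rfl fun i _ => ?_
          rw [Finset.sum_apply, Finset.sum_apply, Finset.sum_apply, Finset.sum_eq_single u]
          · simp [outerProduct, c]
          · intro v _ hv; simp [outerProduct, hv]
          · simp
        · intro j' _ hj
          refine Finset.sum_eq_zero fun i _ => ?_
          rw [Finset.sum_apply, Finset.sum_apply, Finset.sum_apply, Finset.sum_eq_zero]
          · simp
          intro v _
          by_cases hv : v = u
          · subst hv; simp [outerProduct, hj]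
          · simp [outerProduct, hv]
        · simp
        · intro k _ hk
          refine Finset.sum_eq_zero fun i' _ => Finset.sum_eq_zero fun j _ => ?_
          rw [Finset.sum_apply, Finset.sum_apply, Finset.sum_apply, Finset.sum_eq_zero]
          · simp
          intro v _
          by_cases hv : v = u
          · subst hv; simp [outerProduct, c, hk]
          · simp [outerProduct, hv]
        · simp
      · have := hf (0, 0, Pi.single v (Pi.single u 1))
        rw [hF', hZ, Finset.sum_eq_single u] at this
        · rw [← this]
          refine Finset.sum_congr rfl fun i _ => Finset.sum_congr rfl fun j _ => ?_
          rw [Finset.sum_apply, Finset.sum_apply, Finset.sum_apply, Finset.sum_eq_single v]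
          · simp [outerProduct]
          · intro w _ hw; simp [outerProduct, hw]
          · simp
        · intro k _ hk
          refine Finset.sum_eq_zero fun i' _ => Finset.sum_eq_zero fun j _ => ?_
          rw [Finset.sum_apply, Finset.sum_apply, Finset.sum_apply, Finset.sum_eq_zero]
          · simp
          intro w _
          by_cases hv : w = v
          · subst hv; simp [outerProduct, hk]
          · simp [outerProduct, hv]
        · simp
    refine hf0 (LinearMap.ext fun T => ?_)
    rw [hZ, LinearMap.zero_apply]
    refine Finset.sum_eq_zero fun k _ => Finset.sum_eq_zero fun i _ => Finset.sum_eq_zero fun j _ => ?_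
    have : Z i j k = 0 := congrFun (congrFun (hZ0 k) i) j
    rw [this, mul_zero]
  have hmap := hF.map_nhds_eq_of_surj hsurj
  have hslice : slices (F (a, b, c)) = fun u => rankOne (a u) (b u) := by
    funext k i j
    simp only [slices, hFdef, Finset.sum_apply, outerProduct, rankOne, c]
    rw [Finset.sum_eq_single k]
    · simp
    · intro u _ hu; simp [hu.symm]
    · simp
  have h1 : ∀ᶠ T in 𝓝 (F (a, b, c)), IsSumOfOuterProducts T p := by
    rw [← hmap, eventually_map]
    exact Eventually.of_forall fun x => ⟨x.1, x.2.1, x.2.2, rfl⟩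
  have h2 : ∀ᶠ T in 𝓝 (F (a, b, c)), LinearIndependent ℝ (slices T) :=
    (isOpen_linearIndependent_slices m n p).mem_nhds (by
      change LinearIndependent ℝ (slices (F (a, b, c))); rwa [hslice])
  obtain ⟨S, hS, hSo, hmem⟩ := eventually_nhds_iff.1 (h1.and h2)
  refine ⟨S, hSo.measurableSet, hSo.measure_pos volume ⟨_, hmem⟩, fun T hT => ?_⟩
  exact le_antisymm (Nat.sInf_le (hS T hT).1)
    (le_of_isSumOfOuterProducts (hS T hT).2 (isSumOfOuterProducts_tensorRank T))

/-! ### Nonsingular bilinear maps -/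

/-- A bilinear map is nonsingular if it vanishes only when one of its arguments does. -/
def HasNonsingularBilinearMap (X Y Z : Type*) [AddCommGroup X] [Module ℝ X] [AddCommGroup Y]
    [Module ℝ Y] [AddCommGroup Z] [Module ℝ Z] : Prop :=
  ∃ B : X →ₗ[ℝ] Y →ₗ[ℝ] Z, ∀ x y, B x y = 0 → x = 0 ∨ y = 0

section

variable {X Y Z : Type*} [AddCommGroup X] [Module ℝ X] [AddCommGroup Y] [Module ℝ Y]
  [AddCommGroup Z] [Module ℝ Z]

theorem HasNonsingularBilinearMap.pi (h : HasNonsingularBilinearMap X Y Z) (ι : Type*) :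
    HasNonsingularBilinearMap X (ι → Y) (ι → Z) := by
  obtain ⟨B, hB⟩ := h
  refine ⟨LinearMap.mk₂ ℝ (fun x y i => B x (y i)) ?_ ?_ ?_ ?_, fun x y hxy => ?_⟩
  · intros; ext; simp
  · intros; ext; simp
  · intros; ext; simp
  · intros; ext; simp
  · by_cases hx : x = 0
    · exact Or.inl hx
    · exact Or.inr (funext fun i => (hB x (y i) (congrFun hxy i)).resolve_left hx)

theorem exists_injective_linearMap_of_le_finrank {m : ℕ} (h : m ≤ Module.finrank ℝ X) :
    ∃ f : (Fin m → ℝ) →ₗ[ℝ] X, Function.Injective f := by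
  obtain ⟨v, hv⟩ := exists_linearIndependent_of_le_finrank h
  exact ⟨Fintype.linearCombination ℝ v, linearIndependent_iff_injective_fintypeLinearCombination.1 hv⟩

theorem HasNonsingularBilinearMap.fin [FiniteDimensional ℝ Z] (h : HasNonsingularBilinearMap X Y Z)
    {m n q : ℕ} (hm : m ≤ Module.finrank ℝ X) (hn : n ≤ Module.finrank ℝ Y)
    (hq : Module.finrank ℝ Z = q) :
    HasNonsingularBilinearMap (Fin m → ℝ) (Fin n → ℝ) (Fin q → ℝ) := by
  obtain ⟨B, hB⟩ := h
  obtain ⟨f, hf⟩ := exists_injective_linearMap_of_le_finrank hm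
  obtain ⟨g, hg⟩ := exists_injective_linearMap_of_le_finrank hn
  let e : Z ≃ₗ[ℝ] (Fin q → ℝ) := LinearEquiv.ofFinrankEq _ _ (by simp [hq])
  refine ⟨(B.compl₁₂ f g).compr₂ e.toLinearMap, fun x y hxy => ?_⟩
  have : B (f x) (g y) = 0 := by simpa using hxy
  rcases hB _ _ this with h | h
  · exact Or.inl (hf (h.trans f.map_zero.symm))
  · exact Or.inr (hg (h.trans g.map_zero.symm))

end

theorem hasNonsingularBilinearMap_quaternion : HasNonsingularBilinearMap ℍ[ℝ] ℍ[ℝ] ℍ[ℝ] :=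
  ⟨LinearMap.mul ℝ ℍ[ℝ], fun _ _ h => mul_eq_zero.1 h⟩

/-- Octonion multiplication, by the Cayley–Dickson construction. -/
noncomputable def octonionMul : (ℍ[ℝ] × ℍ[ℝ]) →ₗ[ℝ] (ℍ[ℝ] × ℍ[ℝ]) →ₗ[ℝ] (ℍ[ℝ] × ℍ[ℝ]) :=
  LinearMap.mk₂ ℝ (fun x y => (x.1 * y.1 - star y.2 * x.2, y.2 * x.1 + x.2 * star y.1))
    (by intros; ext1 <;> simp [mul_add, add_mul] <;> abel)
    (by intros; ext1 <;> simp [smul_sub])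
    (by intros; ext1 <;> simp [mul_add, add_mul] <;> abel)
    (by intros; ext1 <;> simp [smul_sub])

/-- Multiplication by the conjugate octonion. -/
noncomputable def octonionConjMul : (ℍ[ℝ] × ℍ[ℝ]) →ₗ[ℝ] (ℍ[ℝ] × ℍ[ℝ]) →ₗ[ℝ] (ℍ[ℝ] × ℍ[ℝ]) :=
  LinearMap.mk₂ ℝ (fun x y => (star x.1 * y.1 + star y.2 * x.2, y.2 * star x.1 - x.2 * star y.1))
    (by intros; ext1 <;> simp [mul_add, add_mul] <;> abel)
    (by intros; ext1 <;> simp [smul_sub])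
    (by intros; ext1 <;> simp [mul_add, add_mul] <;> abel)
    (by intros; ext1 <;> simp [smul_sub])

/-- The squared norm of an octonion. -/
noncomputable def octonionNormSq (x : ℍ[ℝ] × ℍ[ℝ]) : ℝ :=
  Quaternion.normSq x.1 + Quaternion.normSq x.2

/-- This identity replaces associativity: left multiplication by a nonzero octonion is injective. -/
theorem octonionConjMul_octonionMul (x y : ℍ[ℝ] × ℍ[ℝ]) :
    octonionConjMul x (octonionMul x y) = octonionNormSq x • y := by
  obtain ⟨x, x'⟩ := x
  obtain ⟨y, y'⟩ := y
  refine Prod.ext ?_ ?_ <;> ext <;>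
    simp [octonionConjMul, octonionMul, octonionNormSq, Quaternion.normSq_def'] <;> ring

theorem octonionMul_octonionConjMul (x y : ℍ[ℝ] × ℍ[ℝ]) :
    octonionMul x (octonionConjMul x y) = octonionNormSq x • y := by
  obtain ⟨x, x'⟩ := x
  obtain ⟨y, y'⟩ := y
  refine Prod.ext ?_ ?_ <;> ext <;>
    simp [octonionConjMul, octonionMul, octonionNormSq, Quaternion.normSq_def'] <;> ring

theorem octonionNormSq_nonneg (x : ℍ[ℝ] × ℍ[ℝ]) : 0 ≤ octonionNormSq x :=
  add_nonneg Quaternion.normSq_nonneg Quaternion.normSq_nonneg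

theorem eq_zero_of_octonionNormSq_eq_zero {x : ℍ[ℝ] × ℍ[ℝ]} (h : octonionNormSq x = 0) : x = 0 := by
  have h' := (add_eq_zero_iff_of_nonneg Quaternion.normSq_nonneg Quaternion.normSq_nonneg).1 h
  exact Prod.ext (Quaternion.normSq_eq_zero.1 h'.1) (Quaternion.normSq_eq_zero.1 h'.2)

theorem hasNonsingularBilinearMap_octonion :
    HasNonsingularBilinearMap (ℍ[ℝ] × ℍ[ℝ]) (ℍ[ℝ] × ℍ[ℝ]) (ℍ[ℝ] × ℍ[ℝ]) := by
  refine ⟨octonionMul, fun x y h => ?_⟩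
  have := octonionConjMul_octonionMul x y
  rw [h, map_zero] at this
  exact (smul_eq_zero.1 this.symm).imp_left eq_zero_of_octonionNormSq_eq_zero

/-- If left multiplications by `X` on `W` are similarities, then `X ⊕ ℂ` acts in the same way on the
complexification of `W ⊕ W`. -/
theorem HasNonsingularBilinearMap.prod_of_similarity {X W : Type*} [AddCommGroup X] [Module ℝ X]
    [AddCommGroup W] [Module ℝ W] (O O' : X →ₗ[ℝ] W →ₗ[ℝ] W) (N : X → ℝ)
    (h1 : ∀ x w, O' x (O x w) = N x • w) (h2 : ∀ x w, O x (O' x w) = N x • w)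
    (hN : ∀ x, 0 ≤ N x) (hN0 : ∀ x, N x = 0 → x = 0) :
    HasNonsingularBilinearMap (X × ℝ × ℝ) ((W × W) × (W × W)) ((W × W) × (W × W)) := by
  -- With `z = s + it`, `u = u₁ + iu₂`, `v = v₁ + iv₂`, this is `(u, v) ↦ (zu - O'v, Ou + z̄v)`. At
  -- a zero, applying `O'` to `Ou = -z̄v` gives `(N x + |z|²)u = 0`, and likewise for `v`.
  refine ⟨LinearMap.mk₂ ℝ (fun x y =>
    ((x.2.1 • y.1.1 - x.2.2 • y.1.2 - O' x.1 y.2.1, x.2.1 • y.1.2 + x.2.2 • y.1.1 - O' x.1 y.2.2),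
      (O x.1 y.1.1 + x.2.1 • y.2.1 + x.2.2 • y.2.2, O x.1 y.1.2 + x.2.1 • y.2.2 - x.2.2 • y.2.1)))
    ?_ ?_ ?_ ?_, ?_⟩
  · intros; refine Prod.ext (Prod.ext ?_ ?_) (Prod.ext ?_ ?_) <;> simp <;> module
  · intros; refine Prod.ext (Prod.ext ?_ ?_) (Prod.ext ?_ ?_) <;> simp <;> module
  · intros; refine Prod.ext (Prod.ext ?_ ?_) (Prod.ext ?_ ?_) <;> simp <;> module
  · intros; refine Prod.ext (Prod.ext ?_ ?_) (Prod.ext ?_ ?_) <;> simp <;> module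
  rintro ⟨x, s, t⟩ ⟨⟨u₁, u₂⟩, v₁, v₂⟩ h
  simp only [LinearMap.mk₂_apply, Prod.mk_eq_zero] at h
  obtain ⟨⟨e1, e2⟩, e3, e4⟩ := h
  have e1 : O' x v₁ = s • u₁ - t • u₂ := (sub_eq_zero.1 e1).symm
  have e2 : O' x v₂ = s • u₂ + t • u₁ := (sub_eq_zero.1 e2).symm
  have e3 : O x u₁ = -(s • v₁ + t • v₂) := eq_neg_of_add_eq_zero_left (by rw [← e3]; abel)
  have e4 : O x u₂ = -(s • v₂ - t • v₁) := eq_neg_of_add_eq_zero_left (by rw [← e4]; abel)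
  have f1 := h1 x u₁
  have f2 := h1 x u₂
  have f3 := h2 x v₁
  have f4 := h2 x v₂
  rw [e3, map_neg, map_add, map_smul, map_smul, e1, e2] at f1
  rw [e4, map_neg, map_sub, map_smul, map_smul, e1, e2] at f2
  rw [e1, map_sub, map_smul, map_smul, e3, e4] at f3
  rw [e2, map_add, map_smul, map_smul, e3, e4] at f4
  have g1 : (N x + s ^ 2 + t ^ 2) • u₁ = 0 := by
    rw [add_smul, add_smul, ← f1]; module
  have g2 : (N x + s ^ 2 + t ^ 2) • u₂ = 0 := by
    rw [add_smul, add_smul, ← f2]; module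
  have g3 : (N x + s ^ 2 + t ^ 2) • v₁ = 0 := by
    rw [add_smul, add_smul, ← f3]; module
  have g4 : (N x + s ^ 2 + t ^ 2) • v₂ = 0 := by
    rw [add_smul, add_smul, ← f4]; module
  by_cases h0 : N x + s ^ 2 + t ^ 2 = 0
  · left
    have hx := hN x
    have hN : N x = 0 := by nlinarith [sq_nonneg s, sq_nonneg t]
    have hs : s = 0 := by nlinarith [sq_nonneg s, sq_nonneg t]
    have ht : t = 0 := by nlinarith [sq_nonneg s, sq_nonneg t]
    rw [hN0 x hN, hs, ht]; rfl
  · right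
    rw [(smul_eq_zero.1 g1).resolve_left h0, (smul_eq_zero.1 g2).resolve_left h0,
      (smul_eq_zero.1 g3).resolve_left h0, (smul_eq_zero.1 g4).resolve_left h0]
    rfl

theorem exists_nonsingular_add_sub_two {m n : ℕ} (hmn : m ≤ n)
    (hcases : (m = 3 ∧ n ≡ 3 [MOD 4]) ∨ (m = 4 ∧ n ≡ 2 [MOD 4]) ∨
      (m = 6 ∧ n ≡ 4 [MOD 8]) ∨ (m = 10 ∧ n ≡ 24 [MOD 32])) :
    HasNonsingularBilinearMap (Fin m → ℝ) (Fin n → ℝ) (Fin (m + n - 2) → ℝ) := by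
  rcases hcases with ⟨rfl, h⟩ | ⟨rfl, h⟩ | ⟨rfl, h⟩ | ⟨rfl, h⟩
  -- In every case the congruence makes `m + n - 2` a multiple of the algebra's or module's
  -- dimension; the number of copies is the quotient.
  · refine (hasNonsingularBilinearMap_quaternion.pi (Fin ((n + 1) / 4))).fin ?_ ?_ ?_ <;>
      simp [Module.finrank_pi_fintype, Quaternion.finrank_eq_four, Nat.ModEq] at * <;> omega
  · refine (hasNonsingularBilinearMap_quaternion.pi (Fin ((n + 2) / 4))).fin ?_ ?_ ?_ <;>
      simp [Module.finrank_pi_fintype, Quaternion.finrank_eq_four, Nat.ModEq] at * <;> omega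
  · refine (hasNonsingularBilinearMap_octonion.pi (Fin ((n + 4) / 8))).fin ?_ ?_ ?_ <;>
      simp [Module.finrank_pi_fintype, Quaternion.finrank_eq_four, Nat.ModEq] at * <;> omega
  · refine ((HasNonsingularBilinearMap.prod_of_similarity octonionMul octonionConjMul octonionNormSq
      octonionConjMul_octonionMul octonionMul_octonionConjMul octonionNormSq_nonneg
      fun _ => eq_zero_of_octonionNormSq_eq_zero).pi (Fin ((n + 8) / 32))).fin ?_ ?_ ?_ <;>
      simp [Module.finrank_pi_fintype, Quaternion.finrank_eq_four, Nat.ModEq] at * <;> omega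

/-! ### Tensors of rank greater than `p` -/

/-- By scaling, `a` and `b` may be taken on unit spheres. Independence of the slices together with
`a bᵀ` is open in `(a, b, T)`, and projection along a compact factor is closed. -/
theorem isOpen_forall_rankOne_notMem_span (m n p : ℕ) :
    IsOpen {T : Tensor3 m n p | LinearIndependent ℝ (slices T) ∧
      ∀ a : Fin m → ℝ, a ≠ 0 → ∀ b : Fin n → ℝ, b ≠ 0 →
        rankOne a b ∉ Submodule.span ℝ (Set.range (slices T))} := by
  let K := Metric.sphere (0 : Fin m → ℝ) 1 × Metric.sphere (0 : Fin n → ℝ) 1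
  let C : Set (K × Tensor3 m n p) := {x | LinearIndependent ℝ
    (Fin.cons (rankOne x.1.1.1 x.1.2.1) (slices x.2) : Fin (p + 1) → Fin m → Fin n → ℝ)}
  have hC : IsOpen C := by
    refine isOpen_setOfPred_linearIndependent.preimage (continuous_pi fun k => ?_)
    refine Fin.cases ?_ (fun k => ?_) k
    · exact continuous_pi fun i => continuous_pi fun j => by
        exact ((continuous_apply i).comp
          (continuous_subtype_val.comp (continuous_fst.comp continuous_fst))).mul
          ((continuous_apply j).comp
            (continuous_subtype_val.comp (continuous_snd.comp continuous_fst)))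
    · exact continuous_pi fun i => continuous_pi fun j => by
        change Continuous fun x : K × Tensor3 m n p => x.2 i j k
        fun_prop
  have hcl := isClosedMap_snd_of_compactSpace (X := K) (Y := Tensor3 m n p) _ hC.isClosed_compl
  convert (isOpen_linearIndependent_slices m n p).inter hcl.isOpen_compl using 1
  ext T
  refine and_congr_right fun hT => ⟨fun h => ?_, fun h a ha b hb => ?_⟩
  · rintro ⟨⟨⟨⟨a, ha⟩, ⟨b, hb⟩⟩, T'⟩, hx, rfl⟩
    refine hx (linearIndependent_finCons.2 ⟨hT, h a ?_ b ?_⟩)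
    · rintro rfl; simp at ha
    · rintro rfl; simp at hb
  · intro hmem
    have ha' := norm_ne_zero_iff.2 ha
    have hb' := norm_ne_zero_iff.2 hb
    refine h ⟨((⟨‖a‖⁻¹ • a, by simp [norm_smul, ha']⟩, ⟨‖b‖⁻¹ • b, by simp [norm_smul, hb']⟩), T),
      fun hx => (linearIndependent_finCons.1 hx).2 ?_, rfl⟩
    have : rankOne (‖a‖⁻¹ • a) (‖b‖⁻¹ • b) = (‖a‖⁻¹ * ‖b‖⁻¹) • rankOne a b := by
      funext i j
      simp only [rankOne, Pi.smul_apply, smul_eq_mul]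
      ring
    simp only [this]
    exact Submodule.smul_mem _ _ hmem

theorem lt_of_isSumOfOuterProducts {m n p r : ℕ} {T : Tensor3 m n p} (hp : 0 < p)
    (hT : LinearIndependent ℝ (slices T)) (hspan : ∀ a : Fin m → ℝ, a ≠ 0 → ∀ b : Fin n → ℝ, b ≠ 0 →
      rankOne a b ∉ Submodule.span ℝ (Set.range (slices T)))
    (h : IsSumOfOuterProducts T r) : p < r := by
  refine lt_of_le_of_ne (le_of_isSumOfOuterProducts hT h) ?_
  rintro rfl
  obtain ⟨a, b, c, h⟩ := h
  have hle : Submodule.span ℝ (Set.range (slices T)) ≤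
      Submodule.span ℝ (Set.range fun u => rankOne (a u) (b u)) :=
    Submodule.span_le.2 (by rintro _ ⟨k, rfl⟩; exact slices_mem_span h k)
  have h1 := finrank_span_eq_card hT
  have h2 := finrank_range_le_card (R := ℝ) (fun u => rankOne (a u) (b u))
  have heq := Submodule.eq_of_le_of_finrank_le hle (by rw [h1]; exact h2)
  have hind : LinearIndependent ℝ fun u => rankOne (a u) (b u) := by
    rw [linearIndependent_iff_card_eq_finrank_span, Set.finrank, ← heq, h1]
  have hne := hind.ne_zero (⟨0, hp⟩ : Fin p)
  refine hspan (a ⟨0, hp⟩) (fun h0 => hne ?_) (b ⟨0, hp⟩) (fun h0 => hne ?_) ?_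
  · funext i j; simp [rankOne, h0]
  · funext i j; simp [rankOne, h0]
  · rw [heq]
    exact Submodule.subset_span ⟨⟨0, hp⟩, rfl⟩

/-- The kernel of the linear map induced by a nonsingular bilinear map contains no rank-one
matrices. -/
theorem exists_linearIndependent_rankOne_notMem_span {m n p q : ℕ} (hpq : p + q ≤ m * n)
    (h : HasNonsingularBilinearMap (Fin m → ℝ) (Fin n → ℝ) (Fin q → ℝ)) :
    ∃ v : Fin p → Fin m → Fin n → ℝ, LinearIndependent ℝ v ∧
      ∀ a : Fin m → ℝ, a ≠ 0 → ∀ b : Fin n → ℝ, b ≠ 0 →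
        rankOne a b ∉ Submodule.span ℝ (Set.range v) := by
  obtain ⟨B, hB⟩ := h
  -- The factorization of `B` through the tensor product, with matrices as tensors.
  let Φ : (Fin m → Fin n → ℝ) →ₗ[ℝ] (Fin q → ℝ) :=
    ∑ i, ∑ j, ((LinearMap.proj (R := ℝ) (φ := fun _ : Fin n => ℝ) j).comp
      (LinearMap.proj (R := ℝ) (φ := fun _ : Fin m => Fin n → ℝ) i)).smulRight
        (B (Pi.single i 1) (Pi.single j 1))
  have hΦ : ∀ a b, Φ (rankOne a b) = B a b := by
    intro a b
    have ha : a = ∑ i, a i • Pi.single i (1 : ℝ) := by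
      simpa [← Pi.single_smul] using (Finset.univ_sum_single a).symm
    have hb : b = ∑ i, b i • Pi.single i (1 : ℝ) := by
      simpa [← Pi.single_smul] using (Finset.univ_sum_single b).symm
    conv_rhs => rw [ha, hb]
    simp [Φ, rankOne, LinearMap.sum_apply, map_sum, Finset.smul_sum, smul_smul]
    rw [Finset.sum_comm]
    exact Finset.sum_congr rfl fun _ _ => Finset.sum_congr rfl fun _ _ => by rw [mul_comm]
  have hker : p ≤ Module.finrank ℝ Φ.ker := by
    have h1 := Φ.finrank_range_add_finrank_ker
    have h2 := Submodule.finrank_le Φ.range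
    simp only [Module.finrank_pi_fintype, Module.finrank_self, Finset.sum_const, Finset.card_univ,
      Fintype.card_fin, smul_eq_mul, mul_one] at h1 h2
    omega
  obtain ⟨v, hv⟩ := exists_linearIndependent_of_le_finrank hker
  refine ⟨fun k => (v k).1, hv.map' Φ.ker.subtype Φ.ker.ker_subtype, fun a ha b hb hmem => ?_⟩
  have hsub : Submodule.span ℝ (Set.range fun k => (v k).1) ≤ Φ.ker :=
    Submodule.span_le.2 (by rintro _ ⟨k, rfl⟩; exact (v k).2)
  have : B a b = 0 := by rw [← hΦ]; exact hsub hmem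
  exact (hB a b this).elim ha hb

theorem exists_mem_typicalRanks_gt {m n p q : ℕ} (hp : 0 < p) (hpq : p + q ≤ m * n)
    (h : HasNonsingularBilinearMap (Fin m → ℝ) (Fin n → ℝ) (Fin q → ℝ)) :
    ∃ r ∈ typicalRanks m n p, p < r := by
  obtain ⟨v, hv, hv'⟩ := exists_linearIndependent_rankOne_notMem_span hpq h
  obtain ⟨r, hr, T, hT, rfl⟩ := exists_mem_typicalRanks_of_isOpen
    (isOpen_forall_rankOne_notMem_span m n p) ⟨fun i j k => v k i j, hv, hv'⟩
  exact ⟨_, hr, lt_of_isSumOfOuterProducts hp hT.1 hT.2 (isSumOfOuterProducts_tensorRank T)⟩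

/-! ### An explicit transversal configuration -/

/-- First factors of rank-one matrices spanning a transversal linear section. -/
noncomputable def sectionVector (M N : ℕ) : Option (Fin M × Fin N) → Fin (M + 1) → ℝ
  | none => Pi.single 0 1
  | some (i, j) => Fin.cons 1 (Pi.single i ((i : ℝ) + j + 1))

/-- Second factors of rank-one matrices spanning a transversal linear section. -/
noncomputable def sectionCovector (M N : ℕ) : Option (Fin M × Fin N) → Fin (N + 1) → ℝ
  | none => Pi.single 0 1
  | some (i, j) => Fin.cons 1 (Pi.single j ((i : ℝ) + j + 1))

theorem linearIndependent_section (M N : ℕ) :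
    LinearIndependent ℝ fun u => rankOne (sectionVector M N u) (sectionCovector M N u) := by
  rw [Fintype.linearIndependent_iff]
  intro g hg
  have hsome : ∀ i j, g (some (i, j)) = 0 := by
    intro i j
    have := congrFun (congrFun hg i.succ) j.succ
    simp only [Fintype.sum_option, Finset.sum_apply, Pi.smul_apply, rankOne,
      -- Outside row and column `0`, the matrix of index `(i, j)` has a single nonzero entry, at
      -- `(i, j)`.
      sectionVector, sectionCovector, Fin.cons_succ, smul_eq_mul, Pi.zero_apply] at this
    rw [Finset.sum_eq_single (i, j)] at this
    · simp only [Pi.single_eq_same] at this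
      have hpos : (0 : ℝ) < (i : ℝ) + j + 1 := by positivity
      simpa [hpos.ne'] using this
    · rintro ⟨i', j'⟩ - hne
      by_cases hi : i = i'
      · have hj : j ≠ j' := by rintro rfl; exact hne (by rw [hi])
        simp [hj]
      · simp [hi]
    · simp
  have hnone : g none = 0 := by
    have := congrFun (congrFun hg 0) 0
    simpa [Fintype.sum_option, Finset.sum_apply, rankOne, sectionVector, sectionCovector,
      hsome] using this
  rintro (_ | ⟨i, j⟩)
  · exact hnone
  · exact hsome i j

/-- The weights `i + j + 1` matter only through being nonzero and distinct along each row and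
column. At the point `(k, l)`, the tangency and span equations for `Z k.succ j.succ` differ by the
factor `j - l`, which forces that entry to vanish for `j ≠ l`; columns are symmetric. -/
theorem section_transversal (M N : ℕ) (u : Option (Fin M × Fin N))
    (Z : Fin (M + 1) → Fin (N + 1) → ℝ) (h1 : ∀ i, ∑ j, sectionCovector M N u j * Z i j = 0)
    (h2 : ∀ j, ∑ i, sectionVector M N u i * Z i j = 0)
    (h3 : ∀ v, ∑ i, ∑ j, sectionVector M N v i * sectionCovector M N v j * Z i j = 0) : Z = 0 := by
  have h00 : Z 0 0 = 0 := by
    simpa [sectionVector, sectionCovector, Fin.sum_univ_succ] using h3 none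
  have hdpos : ∀ (i : Fin M) (j : Fin N), (0 : ℝ) < (i : ℝ) + j + 1 := fun i j => by positivity
  have hij : ∀ (i : Fin M) (j : Fin N),
      Z 0 j.succ + Z i.succ 0 + ((i : ℝ) + j + 1) * Z i.succ j.succ = 0 := by
    intro i j
    have := h3 (some (i, j))
    simp only [sectionVector, sectionCovector, Fin.sum_univ_succ, Fin.cons_zero, Fin.cons_succ,
      Pi.single_apply, ite_mul, mul_ite, zero_mul, mul_zero, one_mul, mul_one, Finset.sum_ite_eq',
      Finset.mem_univ, if_true, h00, zero_add,
      Finset.sum_add_distrib] at this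
    refine (mul_eq_zero.1 (?_ : ((i : ℝ) + j + 1) * _ = 0)).resolve_left (hdpos i j).ne'
    linear_combination this
  have hedge : (∀ j : Fin N, Z 0 j.succ = 0) ∧ ∀ i : Fin M, Z i.succ 0 = 0 := by
    rcases u with _ | ⟨k, l⟩
    · exact ⟨fun j => by simpa [sectionVector, Fin.sum_univ_succ] using h2 j.succ,
        fun i => by simpa [sectionCovector, Fin.sum_univ_succ] using h1 i.succ⟩
    · have hcol : ∀ i, Z i 0 + ((k : ℝ) + l + 1) * Z i l.succ = 0 := fun i => by
        simpa [sectionCovector, Fin.sum_univ_succ, Pi.single_apply] using h1 i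
      have hrow : ∀ j, Z 0 j + ((k : ℝ) + l + 1) * Z k.succ j = 0 := fun j => by
        simpa [sectionVector, Fin.sum_univ_succ, Pi.single_apply] using h2 j
      have hk0 : Z k.succ 0 = 0 := by simpa [h00, (hdpos k l).ne'] using hrow 0
      have h0l : Z 0 l.succ = 0 := by simpa [h00, (hdpos k l).ne'] using hcol 0
      constructor
      · intro j
        by_cases hj : j = l
        · rw [hj, h0l]
        have hne : (j : ℝ) - l ≠ 0 := sub_ne_zero.2 (by exact_mod_cast Fin.val_ne_of_ne hj)
        have e1 := hij k j
        have e2 := hrow j.succ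
        have e3 : Z k.succ j.succ = 0 :=
          (mul_eq_zero.1 (by linear_combination e1 - e2 - hk0 : ((j : ℝ) - l) * _ = 0)).resolve_left
            hne
        simpa [e3] using e2
      · intro i
        by_cases hi : i = k
        · rw [hi, hk0]
        have hne : (i : ℝ) - k ≠ 0 := sub_ne_zero.2 (by exact_mod_cast Fin.val_ne_of_ne hi)
        have e1 := hij i l
        have e2 := hcol i.succ
        have e3 : Z i.succ l.succ = 0 :=
          (mul_eq_zero.1 (by linear_combination e1 - e2 - h0l : ((i : ℝ) - k) * _ = 0)).resolve_left
            hne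
        simpa [e3] using e2
  funext i j
  refine Fin.cases (Fin.cases h00 hedge.1 j) (fun i => Fin.cases (hedge.2 i) (fun j => ?_) j) i
  have := hij i j
  rw [hedge.1, hedge.2] at this
  simpa [(hdpos i j).ne'] using this

/-- The generic rank `(m - 1) (n - 1) + 1` is typical over `ℝ`. -/
theorem mul_add_one_mem_typicalRanks (M N : ℕ) :
    M * N + 1 ∈ typicalRanks (M + 1) (N + 1) (M * N + 1) := by
  let e : Fin (M * N + 1) ≃ Option (Fin M × Fin N) := Fintype.equivOfCardEq (by simp)
  refine mem_typicalRanks_of_transversal (fun u => sectionVector M N (e u))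
    (fun u => sectionCovector M N (e u)) ((linearIndependent_section M N).comp e e.injective)
    fun u Z h1 h2 h3 => section_transversal M N (e u) Z h1 h2 fun v => ?_
  simpa using h3 (e.symm v)

theorem mainTheorem2 (m n p : ℕ) (hmn : m ≤ n) (hp : p = (m - 1) * (n - 1) + 1)
    (hcases : (m = 3 ∧ n ≡ 3 [MOD 4]) ∨ (m = 4 ∧ n ≡ 2 [MOD 4]) ∨
      (m = 6 ∧ n ≡ 4 [MOD 8]) ∨ (m = 10 ∧ n ≡ 24 [MOD 32])) :
    ∃ r₁ ∈ typicalRanks m n p, ∃ r₂ ∈ typicalRanks m n p, r₁ ≠ r₂ := by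
  have hns := exists_nonsingular_add_sub_two hmn hcases
  have hm : 0 < m := by omega
  obtain ⟨M, rfl⟩ := Nat.exists_eq_add_one.2 hm
  obtain ⟨N, rfl⟩ := Nat.exists_eq_add_one.2 (hm.trans_le hmn)
  simp only [Nat.add_sub_cancel] at hp
  subst hp
  -- The dimension count is exact: `(MN + 1) + (M + N) = (M + 1)(N + 1)`.
  obtain ⟨r, hr, hlt⟩ := exists_mem_typicalRanks_gt (Nat.succ_pos (M * N))
    (by rw [show M + 1 + (N + 1) - 2 = M + N by omega]; exact le_of_eq (by rw [Nat.succ_eq_add_one]; ring)) hns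
  exact ⟨_, mul_add_one_mem_typicalRanks M N, r, hr, hlt.ne⟩
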